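/- Let $0<H<1$, $0<K\le 1$ and $T\ge 0$. Let $W=W^{H,K}$ be a bifractional Brownian motion, that is, a centered Gaussian process $(W_t)_{t\ge0}$ with $$E[W_sW_t]=2^{-K}\big[(t^{2H}+s^{2H})^K-|s-t|^{2HK}\big],$$ and let $Y^{(1)}_t=2^{(1-K)/2}\,W^{HK}_t$, where $W^{HK}$ is a fractional Brownian motion with Hurst index $HK$, that is, a centered Gaussian process $(W^{HK}_t)_{t\ge 0}$ with $E[W^{HK}_sW^{HK}_t]=\tfrac12\big(t^{2HK}+s^{2HK}-|t-s|^{2HK}\big)$. Assume that almost all sample paths of $W^{H,K}$ and of $W^{HK}$ are continuous on $[0,T]$. (The two processes may live on different probability spaces.) 1. For every continuous $m:[0,T]\to\mathbb R$ and every $c\in\mathbb R$, both sides are finite in $$E\Big[\sup_{0\le t\le T}\max(W_t+m(t),c)\Big]\le E\Big[\sup_{0\le t\le T}\max(Y^{(1)}_t+m(t),c)\Big].$$ 2. For every continuous $m:[0,T]\to\mathbb R$ and every non-decreasing convex $g:\mathbb R\to\mathbb R$, both expectations below exist in $(-\infty,\infty]$, and $$E\Big[g\Big(\sup_{0\le t\le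 T}(W_t+m(t))\Big)\Big]\le E\Big[g\Big(\sup_{0\le t\le T}(Y^{(1)}_t+m(t))\Big)\Big].$$ 3. For every $t\in\mathbb R$ (in particular for $0\le t\le T$), $$\int_t^\infty P\Big(\sup_{0\le s\le T}W_s>u\Big)\,du\le\int_t^\infty P\Big(\sup_{0\le s\le T}Y^{(1)}_s>u\Big)\,du ,$$ or equivalently $$E\Big[\Big(\sup_{0\le s\le T}W_s-t\Big)_+\Big]\le E\Big[\Big(\sup_{0\le s\le T}Y^{(1)}_s-t\Big)_+\Big];$$ indeed, for each of the two processes the integrated tail equals the expectation of the positive part, and is finite. -/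

import Mathlib

open MeasureTheory ProbabilityTheory
open scoped NNReal ENNReal

noncomputable section

/-- Covariance of fractional Brownian motion with Hurst index `H`:
`(t ^ (2H) + s ^ (2H) - |t - s| ^ (2H)) / 2`. -/
def fbmCov (H : ℝ) (s t : ℝ≥0) : ℝ :=
  (1 / 2) * ((t : ℝ) ^ (2 * H) + (s : ℝ) ^ (2 * H) - |(t : ℝ) - s| ^ (2 * H))

/-- Covariance of bifractional Brownian motion with indices `H`, `K`:
`2 ^ (-K) * ((t ^ (2H) + s ^ (2H)) ^ K - |s - t| ^ (2HK))`. -/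
def bifbmCov (H K : ℝ) (s t : ℝ≥0) : ℝ :=
  (1 / 2 ^ K) * (((t : ℝ) ^ (2 * H) + (s : ℝ) ^ (2 * H)) ^ K - |(s : ℝ) - t| ^ (2 * H * K))

/-- `X` is, under `P`, a centered Gaussian process on `[0, ∞)` with covariance function `C`. -/
structure IsCenteredGaussianWithCov {Ω : Type*} [MeasurableSpace Ω] (P : Measure Ω)
    (C : ℝ≥0 → ℝ≥0 → ℝ) (X : ℝ≥0 → Ω → ℝ) : Prop where
  gaussian : IsGaussianProcess X P
  centered : ∀ t, ∫ ω, X t ω ∂P = 0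
  cov_eq : ∀ s t, covariance (X s) (X t) P = C s t

/-- Fractional Brownian motion with Hurst index `H`. -/
def IsFBM {Ω : Type*} [MeasurableSpace Ω] (P : Measure Ω) (H : ℝ) (B : ℝ≥0 → Ω → ℝ) : Prop :=
  IsCenteredGaussianWithCov P (fbmCov H) B

/-- Bifractional Brownian motion with indices `H`, `K`. -/
def IsBifBM {Ω : Type*} [MeasurableSpace Ω] (P : Measure Ω) (H K : ℝ) (W : ℝ≥0 → Ω → ℝ) : Prop :=
  IsCenteredGaussianWithCov P (bifbmCov H K) W

/-- Almost every sample path is continuous on `[0, T]`. -/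
def HasContinuousPathsOn {Ω : Type*} [MeasurableSpace Ω] (P : Measure Ω) (T : ℝ≥0)
    (X : ℝ≥0 → Ω → ℝ) : Prop :=
  ∀ᵐ ω ∂P, ContinuousOn (fun t => X t ω) (Set.Icc 0 T)

/-- The supremum of `x` over `[0, T]`; every use below is for a function which is continuous on
`[0, T]` (for almost every sample point), hence bounded there. -/
def supOn (T : ℝ≥0) (x : ℝ≥0 → ℝ) : ℝ := ⨆ t : Set.Icc (0 : ℝ≥0) T, x t

/-- The expectation `E[Z] = E[Z⁺] - E[Z⁻]` as an extended real number. It is the usual one when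
`Z` is almost everywhere measurable and `E[Z⁻]` is finite, with value in `(-∞, ∞]`. -/
def extExp {Ω : Type*} [MeasurableSpace Ω] (P : Measure Ω) (Z : Ω → ℝ) : EReal :=
  ((∫⁻ ω, ENNReal.ofReal (Z ω) ∂P : ℝ≥0∞) : EReal)
    - ((∫⁻ ω, ENNReal.ofReal (-Z ω) ∂P : ℝ≥0∞) : EReal)

/-- The expectation of `Z` exists with value in `(-∞, ∞]`: `Z` is almost everywhere measurable
and its negative part has a finite expectation. -/
def HasExtExp {Ω : Type*} [MeasurableSpace Ω] (P : Measure Ω) (Z : Ω → ℝ) : Prop :=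
  AEMeasurable Z P ∧ ∫⁻ ω, ENNReal.ofReal (-Z ω) ∂P < ∞

end

/-! With `a = s ^ (2H)` and `b = t ^ (2H)`, the covariance of `Y` minus that of `W` is `2 ^ (-K) *
(a ^ K + b ^ K - (a + b) ^ K)`. For `K < 1`, `x ^ K` is a positive multiple of `∫ (1 - exp (-x r)) r
^ (-1 - K) dr` over `r > 0`, and `(1 - e^{-ar}) + (1 - e^{-br}) - (1 - e^{-(a+b)r}) = (1 - e^{-ar})
(1 - e^{-br})`. The difference is thus a mixture of rank-one kernels, hence positive semidefinite
(`posSemidef_fbmCov_sub_bifbmCov`).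

So at finitely many times `Y` has the law of `W` plus an independent centered Gaussian vector
(`map_toLp_eq_conv`). Jensen's inequality in the added vector compares the expectations of
nonnegative convex functions of the coordinates, in particular of `g (max (x i + m i))` with `g`
nonnegative, monotone and convex. Monotone convergence along finite sets increasing to a dense
subset of `[0, T]` carries this to the path suprema (`lintegral_supOn_le`).

A uniform Fernique bound makes the suprema integrable (`integrable_supOn_abs`), which permits signed
`g` by truncation from below. The three claims use the test functions `max x c`, a general `g`, and
`max (x - t) 0`. -/

/-! ### Integral representation of powers and positivity of the covariance difference -/

open Set in
lemma integrableOn_one_sub_exp_mul_rpow {K x : ℝ} (hK0 : 0 < K) (hK1 : K < 1) (hx : 0 ≤ x) :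
    IntegrableOn (fun r : ℝ => (1 - Real.exp (-(x * r))) * r ^ (-1 - K)) (Ioi 0) := by
  have hm : Measurable (fun r : ℝ => (1 - Real.exp (-(x * r))) * r ^ (-1 - K)) := by fun_prop
  have hnn : ∀ r : ℝ, 0 < r → 0 ≤ (1 - Real.exp (-(x * r))) * r ^ (-1 - K) := by
    intro r hr
    have : Real.exp (-(x * r)) ≤ 1 := Real.exp_le_one_iff.2 
      (neg_nonpos.2 (mul_nonneg hx hr.le))
    exact mul_nonneg (by linarith) (Real.rpow_nonneg hr.le _)
  -- Near `0` the bound `1 - exp (-x r) ≤ x r` leaves `r ^ (-K)`, integrable as `K < 1`; beyond `1`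
  -- the factor is at most `1` and `r ^ (-1 - K)` is integrable as `K > 0`.
  rw [← Ioc_union_Ioi_eq_Ioi zero_le_one]
  refine IntegrableOn.union ?_ ?_
  · have h1 : IntegrableOn (fun r : ℝ => x * r ^ (-K)) (Ioc 0 1) := by
      have := (intervalIntegral.intervalIntegrable_rpow' (a := 0) (b := 1)
        (r := -K) (by linarith)).const_mul x
      rwa [intervalIntegrable_iff, uIoc_of_le zero_le_one] at this
    refine h1.mono' hm.aestronglyMeasurable ?_
    refine ae_restrict_of_forall_mem measurableSet_Ioc fun r hr => ?_
    rw [Real.norm_of_nonneg (hnn r hr.1)]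
    have h2 : 1 - Real.exp (-(x * r)) ≤ x * r := by
      have := Real.add_one_le_exp (-(x * r)); linarith
    calc (1 - Real.exp (-(x * r))) * r ^ (-1 - K) ≤ (x * r) * r ^ (-1 - K) :=
          mul_le_mul_of_nonneg_right h2 (Real.rpow_nonneg hr.1.le _)
      _ = x * r ^ (-K) := by
          rw [mul_assoc, ← Real.rpow_one_add' hr.1.le (by linarith)]; congr 2; ring
  · refine (integrableOn_Ioi_rpow_of_lt (a := -1 - K) (by linarith) zero_lt_one).mono'
      hm.aestronglyMeasurable ?_
    refine ae_restrict_of_forall_mem measurableSet_Ioi fun r (hr : 1 < r) => ?_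
    have hr0 : 0 < r := by linarith
    rw [Real.norm_of_nonneg (hnn r hr0)]
    have := Real.exp_pos (-(x * r))
    exact mul_le_of_le_one_left (Real.rpow_nonneg hr0.le _) (by linarith)

-- Scaling `r ↦ x r`. Only the positivity of the remaining constant matters later.
open Set in
lemma integral_one_sub_exp_mul_rpow {K x : ℝ} (hK0 : 0 < K) (hx : 0 ≤ x) :
    ∫ r in Ioi (0 : ℝ), (1 - Real.exp (-(x * r))) * r ^ (-1 - K) =
      x ^ K * ∫ r in Ioi (0 : ℝ), (1 - Real.exp (-r)) * r ^ (-1 - K) := by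
  rcases hx.eq_or_lt with rfl | hx
  · simp [Real.zero_rpow hK0.ne']
  have h := integral_comp_mul_left_Ioi
    (fun r : ℝ => (1 - Real.exp (-r)) * r ^ (-1 - K)) 0 hx
  rw [mul_zero, smul_eq_mul] at h
  have h2 : ∀ r ∈ Ioi (0 : ℝ), (1 - Real.exp (-(x * r))) * r ^ (-1 - K) =
      x ^ (1 + K) * ((1 - Real.exp (-(x * r))) * (x * r) ^ (-1 - K)) := by
    intro r hr
    rw [Real.mul_rpow hx.le (le_of_lt hr)]
    have : x ^ (1 + K) * x ^ (-1 - K) = 1 := by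
      rw [← Real.rpow_add hx]; simp
    linear_combination (-(1 - Real.exp (-(x * r))) * r ^ (-1 - K)) * this
  rw [setIntegral_congr_fun measurableSet_Ioi h2, integral_const_mul, h, ← mul_assoc]
  congr 1
  rw [← Real.rpow_neg_one, ← Real.rpow_add hx]; congr 1; ring

open Set in
lemma integral_one_sub_exp_neg_mul_rpow_pos {K : ℝ} (hK0 : 0 < K) (hK1 : K < 1) :
    0 < ∫ r in Ioi (0 : ℝ), (1 - Real.exp (-r)) * r ^ (-1 - K) := by
  have hpos : ∀ r ∈ Ioi (0 : ℝ), 0 < (1 - Real.exp (-r)) * r ^ (-1 - K) := by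
    intro r (hr : 0 < r)
    have : Real.exp (-r) < 1 := Real.exp_lt_one_iff.2 (by linarith)
    exact mul_pos (by linarith) (Real.rpow_pos_of_pos hr _)
  rw [setIntegral_pos_iff_support_of_nonneg_ae]
  · have : Ioi (0 : ℝ) ⊆
        Function.support (fun r : ℝ => (1 - Real.exp (-r)) * r ^ (-1 - K)) ∩ Ioi 0 :=
      fun r hr => ⟨(hpos r hr).ne', hr⟩
    exact lt_of_lt_of_le (by simp) (measure_mono this)
  · exact ae_restrict_of_forall_mem measurableSet_Ioi fun r hr => (hpos r hr).le
  · simpa using integrableOn_one_sub_exp_mul_rpow hK0 hK1 zero_le_one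

open Set in
/-- For `0 < K ≤ 1`, the kernel `a ^ K + b ^ K - (a + b) ^ K` is positive semidefinite on
`[0, ∞)`. -/
lemma sum_sum_mul_rpow_add_rpow_sub_nonneg {ι : Type*} (s : Finset ι) (c a : ι → ℝ)
    (ha : ∀ i, 0 ≤ a i) {K : ℝ} (hK0 : 0 < K) (hK1 : K ≤ 1) :
    0 ≤ ∑ i ∈ s, ∑ j ∈ s, c i * c j * (a i ^ K + a j ^ K - (a i + a j) ^ K) := by
  -- At `K = 1` the kernel vanishes identically, while the integral representation diverges at `0`.
  rcases hK1.eq_or_lt with rfl | hK1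
  · simp
  set F := ∫ r in Ioi (0 : ℝ), (1 - Real.exp (-r)) * r ^ (-1 - K) with hF
  have hFpos : 0 < F := integral_one_sub_exp_neg_mul_rpow_pos hK0 hK1
  refine nonneg_of_mul_nonneg_left (b := F) ?_ hFpos
  let f : ℝ → ℝ → ℝ := fun x r => (1 - Real.exp (-(x * r))) * r ^ (-1 - K)
  have hint : ∀ x, 0 ≤ x → IntegrableOn (f x) (Ioi 0) :=
    fun x hx => integrableOn_one_sub_exp_mul_rpow hK0 hK1 hx
  have hval : ∀ x, 0 ≤ x → x ^ K * F = ∫ r in Ioi (0 : ℝ), f x r :=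
    fun x hx => (integral_one_sub_exp_mul_rpow hK0 hx).symm
  have hint2 : ∀ i j, IntegrableOn (fun r => f (a i) r + f (a j) r - f (a i + a j) r) (Ioi 0) :=
    fun i j => ((hint _ (ha i)).add (hint _ (ha j))).sub (hint _ (add_nonneg (ha i) (ha j)))
  have key : ∀ i j, c i * c j * (a i ^ K + a j ^ K - (a i + a j) ^ K) * F =
      ∫ r in Ioi (0 : ℝ), c i * c j * (f (a i) r + f (a j) r - f (a i + a j) r) := by
    intro i j
    have h1 : ∫ r in Ioi (0 : ℝ), (f (a i) r + f (a j) r - f (a i + a j) r) =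
        (∫ r in Ioi (0 : ℝ), (f (a i) r + f (a j) r)) - ∫ r in Ioi (0 : ℝ), f (a i + a j) r :=
      integral_sub ((hint _ (ha i)).add (hint _ (ha j))) (hint _ (add_nonneg (ha i) (ha j)))
    rw [integral_const_mul, h1, integral_add (hint _ (ha i)) (hint _ (ha j)),
      ← hval _ (ha i), ← hval _ (ha j), ← hval _ (add_nonneg (ha i) (ha j))]
    ring
  simp_rw [Finset.sum_mul, key]
  simp_rw [← integral_finsetSum s fun j _ => (hint2 _ j).const_mul _]
  rw [← integral_finsetSum s fun i _ => integrable_finsetSum s fun j _ => (hint2 i j).const_mul _]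
  refine setIntegral_nonneg measurableSet_Ioi fun r (hr : 0 < r) => ?_
  -- For fixed `r` the kernel factors as a product over `i` and `j`, so the quadratic form is a
  -- square.
  have : ∑ i ∈ s, ∑ j ∈ s, c i * c j * (f (a i) r + f (a j) r - f (a i + a j) r) =
      r ^ (-1 - K) * (∑ i ∈ s, c i * (1 - Real.exp (-(a i * r)))) ^ 2 := by
    rw [sq, Finset.sum_mul_sum, Finset.mul_sum]
    refine Finset.sum_congr rfl fun i _ => ?_
    rw [Finset.mul_sum]
    refine Finset.sum_congr rfl fun j _ => ?_
    have he : Real.exp (-((a i + a j) * r)) = Real.exp (-(a i * r)) * Real.exp (-(a j * r)) := by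
      rw [← Real.exp_add]; ring_nf
    simp only [f, he]
    ring
  rw [this]
  exact mul_nonneg (Real.rpow_nonneg hr.le _) (sq_nonneg _)

/-- The covariance of `2 ^ ((1 - K) / 2)` times a fractional Brownian motion with index `H * K`
dominates the bifractional covariance in the positive semidefinite order. -/
lemma posSemidef_fbmCov_sub_bifbmCov {H K : ℝ} (hK0 : 0 < K) (hK1 : K ≤ 1)
    (I : Finset ℝ≥0) :
    (Matrix.of fun i j : I => (2 : ℝ) ^ ((1 - K) / 2) * (2 : ℝ) ^ ((1 - K) / 2) *
      fbmCov (H * K) i j - bifbmCov H K i j).PosSemidef := by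
  -- The normalization of `Y` is the one for which the `|t - s| ^ (2HK)` terms cancel.
  have h2 : (2 : ℝ) ^ ((1 - K) / 2) * (2 : ℝ) ^ ((1 - K) / 2) = 2 * (1 / 2 ^ K) := by
    rw [← Real.rpow_add two_pos, add_halves, Real.rpow_sub two_pos, Real.rpow_one]; ring
  have hp : ∀ t : ℝ≥0, (t : ℝ) ^ (2 * (H * K)) = ((t : ℝ) ^ (2 * H)) ^ K := fun t => by
    rw [← Real.rpow_mul t.coe_nonneg, mul_assoc]
  have hentry : ∀ i j : ℝ≥0, (2 : ℝ) ^ ((1 - K) / 2) * (2 : ℝ) ^ ((1 - K) / 2) *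
      fbmCov (H * K) i j - bifbmCov H K i j = 1 / 2 ^ K * (((i : ℝ) ^ (2 * H)) ^ K +
        ((j : ℝ) ^ (2 * H)) ^ K - ((i : ℝ) ^ (2 * H) + (j : ℝ) ^ (2 * H)) ^ K) := by
    intro i j
    rw [h2, fbmCov, bifbmCov, hp, hp, abs_sub_comm (j : ℝ) (i : ℝ), ← mul_assoc 2 H K,
      add_comm ((j : ℝ) ^ (2 * H))]
    ring
  simp_rw [hentry]
  refine Matrix.PosSemidef.of_dotProduct_mulVec_nonneg ?_ fun x => ?_
  · ext i j
    simp only [Matrix.conjTranspose_apply, Matrix.of_apply, star_trivial]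
    rw [add_comm ((i : ℝ) ^ (2 * H)), add_comm (((i : ℝ) ^ (2 * H)) ^ K)]
  · have h := sum_sum_mul_rpow_add_rpow_sub_nonneg Finset.univ x
      (fun i : I => ((i : ℝ≥0) : ℝ) ^ (2 * H)) (fun i => Real.rpow_nonneg i.1.coe_nonneg _) hK0 hK1
    have h3 : star x ⬝ᵥ (Matrix.of fun i j : I => 1 / 2 ^ K * ((((i : ℝ≥0) : ℝ) ^ (2 * H)) ^ K +
        (((j : ℝ≥0) : ℝ) ^ (2 * H)) ^ K -
          (((i : ℝ≥0) : ℝ) ^ (2 * H) + ((j : ℝ≥0) : ℝ) ^ (2 * H)) ^ K)).mulVec x =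
        1 / 2 ^ K * ∑ i, ∑ j, x i * x j * ((((i : ℝ≥0) : ℝ) ^ (2 * H)) ^ K +
        (((j : ℝ≥0) : ℝ) ^ (2 * H)) ^ K -
          (((i : ℝ≥0) : ℝ) ^ (2 * H) + ((j : ℝ≥0) : ℝ) ^ (2 * H)) ^ K) := by
      simp only [dotProduct, Matrix.mulVec, Matrix.of_apply, star_trivial, Pi.star_apply,
        Finset.mul_sum]
      refine Finset.sum_congr rfl fun i _ => Finset.sum_congr rfl fun j _ => ?_
      ring
    rw [h3]
    positivity

/-! ### Comparison of finite-dimensional Gaussian maxima -/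

section GaussianComparison

variable {Ω Ω' : Type*} [MeasurableSpace Ω] [MeasurableSpace Ω']
  {P : Measure Ω} {P' : Measure Ω'}
  {C C' : ℝ≥0 → ℝ≥0 → ℝ} {X : ℝ≥0 → Ω → ℝ} {X' : ℝ≥0 → Ω' → ℝ}

lemma IsCenteredGaussianWithCov.const_mul (hX : IsCenteredGaussianWithCov P C X) (c : ℝ) :
    IsCenteredGaussianWithCov P (fun s t => c * c * C s t) (fun t ω => c * X t ω) where
  gaussian := hX.gaussian.smul fun _ => c
  centered t := by rw [integral_const_mul, hX.centered, mul_zero]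
  cov_eq s t := by
    rw [covariance_const_mul_left, covariance_const_mul_right, hX.cov_eq, mul_assoc]

lemma IsCenteredGaussianWithCov.hasGaussianLaw_toLp (hX : IsCenteredGaussianWithCov P C X)
    (I : Finset ℝ≥0) :
    HasGaussianLaw (fun ω => WithLp.toLp 2 fun i : I => X i ω) P :=
  (hX.gaussian.hasGaussianLaw I).toLp_pi 2

lemma IsCenteredGaussianWithCov.memLp_two (hX : IsCenteredGaussianWithCov P C X) (t : ℝ≥0) :
    MemLp (X t) 2 P :=
  ((hX.gaussian.hasGaussianLaw {t}).eval ⟨t, by simp⟩).memLp_two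

lemma IsCenteredGaussianWithCov.charFun_map_toLp [IsProbabilityMeasure P]
    (hX : IsCenteredGaussianWithCov P C X)
    (I : Finset ℝ≥0) (t : EuclideanSpace ℝ I) :
    charFun (P.map fun ω => WithLp.toLp 2 fun i : I => X i ω) t =
      Complex.exp (-((∑ i, ∑ j, t i * t j * C i j : ℝ) : ℂ) / 2) := by
  have hin : ∀ ω, inner ℝ t (WithLp.toLp 2 fun i : I => X i ω) = ∑ i, t i * X i ω := by
    intro ω
    simp [PiLp.inner_apply, mul_comm]
  rw [(hX.hasGaussianLaw_toLp I).charFun_map_eq]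
  simp_rw [hin]
  rw [integral_finsetSum Finset.univ fun (i : I) _ =>
    ((hX.memLp_two i).integrable one_le_two).const_mul _,
    variance_fun_sum fun i => (hX.memLp_two _).const_mul _]
  simp_rw [integral_const_mul, hX.centered, covariance_const_mul_left, covariance_const_mul_right,
    hX.cov_eq]
  simp [neg_div, mul_assoc]

/-- If the covariance of `X'` dominates that of `X`, the finite-dimensional laws of `X'` are those
of `X` convolved with a centered Gaussian law. -/
lemma IsCenteredGaussianWithCov.map_toLp_eq_conv [IsProbabilityMeasure P]
    [IsProbabilityMeasure P'] (hX : IsCenteredGaussianWithCov P C X)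
    (hX' : IsCenteredGaussianWithCov P' C' X') {I : Finset ℝ≥0}
    (hI : (Matrix.of fun i j : I => C' i j - C i j).PosSemidef) :
    P'.map (fun ω => WithLp.toLp 2 fun i : I => X' i ω) =
      (P.map fun ω => WithLp.toLp 2 fun i : I => X i ω) ∗
        multivariateGaussian 0 (Matrix.of fun i j : I => C' i j - C i j) := by
  have := (hX.hasGaussianLaw_toLp I).isGaussian_map
  have := (hX'.hasGaussianLaw_toLp I).isGaussian_map
  -- Convolution multiplies characteristic functions, so the quadratic forms in the exponents add.
  refine Measure.ext_of_charFun (funext fun t => ?_)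
  rw [charFun_conv, hX.charFun_map_toLp, hX'.charFun_map_toLp, charFun_multivariateGaussian hI,
    ← Complex.exp_add]
  congr 1
  have : t.ofLp ⬝ᵥ (Matrix.of fun i j : I => C' i j - C i j).mulVec t.ofLp =
      ∑ i, ∑ j, t i * t j * C' i j - ∑ i, ∑ j, t i * t j * C i j := by
    simp only [dotProduct, Matrix.mulVec, Matrix.of_apply, Finset.mul_sum,
      ← Finset.sum_sub_distrib]
    exact Finset.sum_congr rfl fun i _ => Finset.sum_congr rfl fun j _ => by ring
  rw [this]
  simp only [inner_zero_right]
  push_cast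
  ring

/-- **Jensen's inequality** for a nonnegative convex function and a centered shift, without any
integrability of the function. -/
lemma ConvexOn.ofReal_le_lintegral_add {E : Type*} [NormedAddCommGroup E] [NormedSpace ℝ E]
    [CompleteSpace E] [MeasurableSpace E] [BorelSpace E] {φ : E → ℝ} (hφ : ConvexOn ℝ Set.univ φ)
    (hc : Continuous φ) (h0 : ∀ x, 0 ≤ φ x) {ν : Measure E} [IsProbabilityMeasure ν]
    (hi : Integrable id ν) (hν : ∫ y, y ∂ν = 0) (x : E) :
    ENNReal.ofReal (φ x) ≤ ∫⁻ y, ENNReal.ofReal (φ (x + y)) ∂ν := by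
  by_cases hint : Integrable (fun y => φ (x + y)) ν
  · rw [← ofReal_integral_eq_lintegral_ofReal hint (Filter.Eventually.of_forall fun y => h0 _)]
    refine ENNReal.ofReal_le_ofReal ?_
    have hxi : Integrable (fun y => x + y) ν := (integrable_const x).add hi
    have h := hφ.map_integral_le (f := fun y => x + y) hc.continuousOn isClosed_univ (by simp) hxi hint
    have hxe : ∫ y, x + y ∂ν = ∫ _, x ∂ν + ∫ y, y ∂ν := integral_add (integrable_const x) hi
    rwa [hxe, integral_const, hν, probReal_univ, one_smul,
      add_zero] at h
  -- Since `φ` is nonnegative, failure of integrability means that the right-hand side is infinite.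
  · have : ∫⁻ y, ENNReal.ofReal (φ (x + y)) ∂ν = ⊤ := by
      by_contra h
      refine hint ((lintegral_ofReal_ne_top_iff_integrable ?_ ?_).1 h)
      · have := hi.1
        exact (hc.comp (continuous_const.add continuous_id)).comp_aestronglyMeasurable this
      · exact Filter.Eventually.of_forall fun y => h0 _
    rw [this]
    exact le_top

/-- A maximum of affine functions is convex, and a monotone convex function preserves convexity. -/
lemma ConvexOn.comp_finset_sup'_add {ι : Type*} [Fintype ι] [Nonempty ι] {g : ℝ → ℝ}
    (hg : ConvexOn ℝ Set.univ g) (hm : Monotone g) (m : ι → ℝ) :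
    ConvexOn ℝ Set.univ fun x : EuclideanSpace ℝ ι =>
      g (Finset.univ.sup' Finset.univ_nonempty fun i => x i + m i) := by
  refine ⟨convex_univ, fun x _ y _ a b ha hb hab => ?_⟩
  refine le_trans (hm ?_) (hg.2 (Set.mem_univ _) (Set.mem_univ _) ha hb hab)
  refine Finset.sup'_le _ _ fun i hi => ?_
  have h1 := Finset.le_sup' (fun i => x i + m i) hi
  have h2 := Finset.le_sup' (fun i => y i + m i) hi
  simp only [PiLp.add_apply, PiLp.smul_apply, smul_eq_mul]
  calc a * x i + b * y i + m i = a * (x i + m i) + b * (y i + m i) := by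
        linear_combination (-m i) * hab
    _ ≤ _ := add_le_add (mul_le_mul_of_nonneg_left h1 ha) (mul_le_mul_of_nonneg_left h2 hb)

lemma IsCenteredGaussianWithCov.lintegral_sup'_le [IsProbabilityMeasure P]
    [IsProbabilityMeasure P'] (hX : IsCenteredGaussianWithCov P C X)
    (hX' : IsCenteredGaussianWithCov P' C' X') {I : Finset ℝ≥0} (hne : I.Nonempty)
    (hI : (Matrix.of fun i j : I => C' i j - C i j).PosSemidef) (m : ℝ≥0 → ℝ) {g : ℝ → ℝ}
    (hm : Monotone g) (hg : ConvexOn ℝ Set.univ g) (h0 : ∀ x, 0 ≤ g x) :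
    ∫⁻ ω, ENNReal.ofReal (g (I.sup' hne fun t => X t ω + m t)) ∂P ≤
      ∫⁻ ω, ENNReal.ofReal (g (I.sup' hne fun t => X' t ω + m t)) ∂P' := by
  have : Nonempty I := hne.to_subtype
  have hgc : Continuous g := continuousOn_univ.1 (hg.continuousOn isOpen_univ)
  set φ : EuclideanSpace ℝ I → ℝ := fun x =>
    g (Finset.univ.sup' Finset.univ_nonempty fun i => x i + m i) with hφ
  have hφconv : ConvexOn ℝ Set.univ φ := hg.comp_finset_sup'_add hm _
  have hφc : Continuous φ := hgc.comp <| Continuous.finset_sup'_apply _ fun i _ => by fun_prop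
  have hφm : Measurable fun x => ENNReal.ofReal (φ x) := hφc.measurable.ennreal_ofReal
  have hval : ∀ x : ℝ≥0 → ℝ, g (I.sup' hne fun t => x t + m t) =
      φ (WithLp.toLp 2 fun i : I => x i) := by
    intro x
    simp only [hφ]
    congr 1
    refine le_antisymm (Finset.sup'_le _ _ fun t ht => ?_) (Finset.sup'_le _ _ fun i _ => ?_)
    · exact Finset.le_sup' (fun i : I => x i + m i) (Finset.mem_univ ⟨t, ht⟩)
    · exact Finset.le_sup' (fun t => x t + m t) i.2
  simp_rw [fun ω => hval (fun t => X t ω), fun ω => hval (fun t => X' t ω)]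
  rw [← lintegral_map' hφm.aemeasurable (hX.hasGaussianLaw_toLp I).aemeasurable,
    ← lintegral_map' hφm.aemeasurable (hX'.hasGaussianLaw_toLp I).aemeasurable,
    hX.map_toLp_eq_conv hX' hI, Measure.lintegral_conv hφm]
  exact lintegral_mono fun x => hφconv.ofReal_le_lintegral_add hφc (fun x => h0 _)
    IsGaussian.integrable_id integral_id_multivariateGaussian x

end GaussianComparison

/-! ### Suprema of continuous functions through finite sets of times -/

open Filter Topology

/-- An increasing sequence of nonempty finite subsets of `[0, T]` with dense union. -/
structure IsDenseExhaustion (T : ℝ≥0) (I : ℕ → Finset ℝ≥0) : Prop where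
  mono : Monotone I
  nonempty : ∀ n, (I n).Nonempty
  subset : ∀ n, (I n : Set ℝ≥0) ⊆ Set.Icc 0 T
  dense : Set.Icc 0 T ⊆ closure (⋃ n, (I n : Set ℝ≥0))

lemma exists_isDenseExhaustion (T : ℝ≥0) : ∃ I, IsDenseExhaustion T I := by
  classical
  have : Nonempty (Set.Icc (0 : ℝ≥0) T) := ⟨⟨0, by simp⟩⟩
  let d : ℕ → Set.Icc (0 : ℝ≥0) T := TopologicalSpace.denseSeq _
  refine ⟨fun n => (Finset.range (n + 1)).image fun i => (d i : ℝ≥0), ?_, ?_, ?_, ?_⟩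
  · intro a b hab
    exact Finset.image_subset_image (Finset.range_subset_range.2 (by omega))
  · exact fun n => ⟨d 0, Finset.mem_image.2 ⟨0, by simp, rfl⟩⟩
  · intro n t ht
    obtain ⟨i, -, rfl⟩ := Finset.mem_image.1 (Finset.mem_coe.1 ht)
    exact (d i).2
  · intro t ht
    have h := TopologicalSpace.denseRange_denseSeq (Set.Icc (0 : ℝ≥0) T) ⟨t, ht⟩
    have h2 := image_closure_subset_closure_image continuous_subtype_val
      (Set.mem_image_of_mem Subtype.val h)
    refine closure_mono ?_ h2
    rintro _ ⟨_, ⟨i, rfl⟩, rfl⟩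
    exact Set.mem_iUnion.2 ⟨i, Finset.mem_coe.2 (Finset.mem_image.2 ⟨i, by simp, rfl⟩)⟩

section Deterministic

variable {T : ℝ≥0} {x y : ℝ≥0 → ℝ}

/-- The real `⨆` takes the default value `0` on families unbounded above; compactness of `[0, T]`
excludes this case. -/
lemma bddAbove_range_Icc (hx : ContinuousOn x (Set.Icc 0 T)) :
    BddAbove (Set.range fun t : Set.Icc (0 : ℝ≥0) T => x t) := by
  have := isCompact_Icc.bddAbove_image hx
  rwa [Set.image_eq_range] at this

lemma le_supOn (hx : ContinuousOn x (Set.Icc 0 T)) {t : ℝ≥0} (ht : t ∈ Set.Icc 0 T) :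
    x t ≤ supOn T x :=
  le_ciSup (bddAbove_range_Icc hx) (⟨t, ht⟩ : Set.Icc (0 : ℝ≥0) T)

lemma supOn_le {b : ℝ} (h : ∀ t ∈ Set.Icc 0 T, x t ≤ b) : supOn T x ≤ b := by
  have : Nonempty (Set.Icc (0 : ℝ≥0) T) := ⟨⟨0, by simp⟩⟩
  exact ciSup_le fun t => h t t.2

lemma supOn_max_const (hx : ContinuousOn x (Set.Icc 0 T)) (c : ℝ) :
    supOn T (fun t => max (x t) c) = max (supOn T x) c := by
  have h0 : (0 : ℝ≥0) ∈ Set.Icc 0 T := by simp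
  have hxc : ContinuousOn (fun t => max (x t) c) (Set.Icc 0 T) := hx.sup continuousOn_const
  refine le_antisymm (supOn_le fun t ht => max_le_max_right _ (le_supOn hx ht)) (max_le ?_ ?_)
  · exact supOn_le fun t ht => (le_max_left _ _).trans (le_supOn hxc ht)
  · exact (le_max_right _ _).trans (le_supOn hxc h0)

lemma abs_supOn_add_le (hx : ContinuousOn x (Set.Icc 0 T)) (hy : ContinuousOn y (Set.Icc 0 T)) :
    |supOn T fun t => x t + y t| ≤ (supOn T fun t => |x t|) + supOn T fun t => |y t| := by
  have h0 : (0 : ℝ≥0) ∈ Set.Icc 0 T := by simp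
  have hb : ∀ t ∈ Set.Icc 0 T,
      |x t + y t| ≤ (supOn T fun t => |x t|) + supOn T fun t => |y t| := fun t ht =>
    (abs_add_le _ _).trans (add_le_add (le_supOn hx.abs ht) (le_supOn hy.abs ht))
  refine abs_le.2 ⟨?_, supOn_le fun t ht => (le_abs_self _).trans (hb t ht)⟩
  exact (neg_le_of_abs_le (hb 0 h0)).trans (le_supOn (hx.add hy) h0)

variable {I : ℕ → Finset ℝ≥0}

lemma IsDenseExhaustion.monotone_sup' (hI : IsDenseExhaustion T I) (x : ℝ≥0 → ℝ) :
    Monotone fun n => (I n).sup' (hI.nonempty n) x :=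
  fun _ _ hab => Finset.sup'_mono x (hI.mono hab) _

lemma IsDenseExhaustion.tendsto_sup' (hI : IsDenseExhaustion T I)
    (hx : ContinuousOn x (Set.Icc 0 T)) :
    Tendsto (fun n => (I n).sup' (hI.nonempty n) x) atTop (𝓝 (supOn T x)) := by
  refine tendsto_atTop_isLUB (hI.monotone_sup' x) ⟨?_, fun b hb => supOn_le fun t ht => ?_⟩
  · rintro _ ⟨n, rfl⟩
    exact Finset.sup'_le _ _ fun t ht => le_supOn hx (hI.subset n ht)
  -- By density, `x t` is a limit of values at points of the finite sets, so it obeys every upper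
  -- bound of the finite maxima.
  · have hc : ContinuousWithinAt x (⋃ n, (I n : Set ℝ≥0)) t :=
      (hx t ht).mono (Set.iUnion_subset hI.subset)
    have hmem := hc.mem_closure_image (hI.dense ht)
    refine closure_minimal ?_ isClosed_Iic hmem
    rintro _ ⟨s, hs, rfl⟩
    obtain ⟨n, hn⟩ := Set.mem_iUnion.1 hs
    exact (Finset.le_sup' x hn).trans (hb ⟨n, rfl⟩)

end Deterministic

/-! ### Integrability and comparison of path suprema -/

section Supremum

variable {Ω Ω' : Type*} [MeasurableSpace Ω] [MeasurableSpace Ω']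
  {P : Measure Ω} {P' : Measure Ω'}
  {C C' : ℝ≥0 → ℝ≥0 → ℝ} {X : ℝ≥0 → Ω → ℝ} {X' : ℝ≥0 → Ω' → ℝ} {T : ℝ≥0}

lemma aemeasurable_finset_sup' {ι : Type*} {I : Finset ι} (hne : I.Nonempty) {X : ι → Ω → ℝ}
    (hX : ∀ i, AEMeasurable (X i) P) : AEMeasurable (fun ω => I.sup' hne fun i => X i ω) P := by
  have := Finset.sup'_induction hne X (p := fun f => AEMeasurable f P)
    (fun _ h1 _ h2 => h1.sup h2) fun i _ => hX i
  convert this using 1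
  ext ω
  rw [Finset.sup'_apply]

/-- The uncountable supremum is almost surely a limit of finite maxima. -/
lemma aemeasurable_supOn (hX : ∀ t, AEMeasurable (X t) P) (hXc : HasContinuousPathsOn P T X) :
    AEMeasurable (fun ω => supOn T fun t => X t ω) P := by
  obtain ⟨I, hI⟩ := exists_isDenseExhaustion T
  exact aemeasurable_of_tendsto_metrizable_ae atTop
    (fun n => aemeasurable_finset_sup' (hI.nonempty n) hX)
    (hXc.mono fun ω hω => hI.tendsto_sup' hω)

lemma IsCenteredGaussianWithCov.aemeasurable (hX : IsCenteredGaussianWithCov P C X) (t : ℝ≥0) :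
    AEMeasurable (X t) P := (hX.memLp_two t).1.aemeasurable

open Real in
/-- **Fernique's theorem**, in a form which is uniform over the centered Gaussian measures: if a
ball of radius `a` has mass at least `3 / 4`, then the norm has a first moment which is bounded
in terms of `a`. -/
lemma exists_lintegral_norm_le_of_measure_ball_ge {a : ℝ} (ha : 0 < a) :
    ∃ M : ℝ≥0∞, M < ∞ ∧ ∀ (E : Type) [NormedAddCommGroup E] [NormedSpace ℝ E]
      [SecondCountableTopology E] [CompleteSpace E] [MeasurableSpace E] [BorelSpace E]
      (μ : Measure E) [IsGaussian μ], μ[id] = 0 → ENNReal.ofReal (3 / 4) ≤ μ {x | ‖x‖ ≤ a} →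
        ∫⁻ x, ENNReal.ofReal ‖x‖ ∂μ ≤ M := by
  set c : ℝ≥0∞ := ENNReal.ofReal (3 / 4) with hc
  have h1c : 1 - c = ENNReal.ofReal (1 / 4) := by
    rw [hc, ← ENNReal.ofReal_one, ← ENNReal.ofReal_sub _ (by norm_num)]; norm_num
  have hc_gt : 2⁻¹ < c := by
    rw [hc, ← ENNReal.ofReal_ofNat, ← ENNReal.ofReal_inv_of_pos two_pos]
    exact (ENNReal.ofReal_lt_ofReal_iff (by norm_num)).2 (by norm_num)
  have hc_lt : c < 1 := by
    rw [hc, ← ENNReal.ofReal_one]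
    exact (ENNReal.ofReal_lt_ofReal_iff (by norm_num)).2 (by norm_num)
  -- Mass `3 / 4 > 1 / 2` makes this ratio exceed `1`; its positive logarithm gives the decay of the
  -- series in `S`.
  have hratio : (c / (1 - c)).toReal = 3 := by
    rw [h1c, hc, ← ENNReal.ofReal_div_of_pos (by norm_num),
      ENNReal.toReal_ofReal (by norm_num)]; norm_num
  set α := Fernique.logRatio c * a⁻¹ ^ 2 with hα
  have hαpos : 0 < α := mul_pos (Fernique.logRatio_pos hc_gt hc_lt) (by positivity)
  set S : ℝ≥0∞ := .ofReal (rexp (Fernique.logRatio c))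
    + ∑' n : ℕ, .ofReal (rexp (-2⁻¹ * Real.log (c / (1 - c)).toReal * 2 ^ n)) with hS
  have hSfin : S < ∞ := by
    refine ENNReal.add_lt_top.mpr ⟨ENNReal.ofReal_lt_top, ?_⟩
    refine Summable.tsum_ofReal_lt_top <|
      Real.summable_exp_nat_mul_of_ge ?_ (fun i ↦ mod_cast (Nat.lt_pow_self (by simp)).le)
    rw [hratio]
    exact mul_neg_of_neg_of_pos (by simp) (Real.log_pos (by norm_num))
  refine ⟨ENNReal.ofReal (1 + 1 / α) * S, ENNReal.mul_lt_top ENNReal.ofReal_lt_top hSfin, ?_⟩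
  intro E _ _ _ _ _ _ μ _ hμ hball
  -- The product of a centered Gaussian measure with itself is rotation invariant. The resulting
  -- exponential bound involves only `c` and `a`, not `E` or `μ`.
  have hbound := lintegral_exp_mul_sq_norm_le_of_map_rotation_eq_self
    (IsGaussian.map_rotation_eq_self hμ _) hball hc_gt
  calc ∫⁻ x, ENNReal.ofReal ‖x‖ ∂μ
      ≤ ∫⁻ x, ENNReal.ofReal (1 + 1 / α) * ENNReal.ofReal (rexp (α * ‖x‖ ^ 2)) ∂μ := by
        refine lintegral_mono fun x => ?_
        rw [← ENNReal.ofReal_mul (by positivity)]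
        refine ENNReal.ofReal_le_ofReal ?_
        have h1 := Real.add_one_le_exp (α * ‖x‖ ^ 2)
        have h2 : ‖x‖ ≤ (1 + 1 / α) * (α * ‖x‖ ^ 2 + 1) := by
          have : (1 + 1 / α) * (α * ‖x‖ ^ 2 + 1) = α * ‖x‖ ^ 2 + 1 + ‖x‖ ^ 2 + 1 / α := by
            field_simp; ring
          rw [this]
          have h3 : 0 ≤ α * ‖x‖ ^ 2 := by positivity
          have h4 : 0 < 1 / α := by positivity
          nlinarith [sq_nonneg (‖x‖ - 1)]
        exact h2.trans (mul_le_mul_of_nonneg_left h1 (by positivity))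
    _ = ENNReal.ofReal (1 + 1 / α) * ∫⁻ x, ENNReal.ofReal (rexp (α * ‖x‖ ^ 2)) ∂μ :=
        lintegral_const_mul _ (by fun_prop)
    _ ≤ _ := by gcongr

/-- `N` is real-valued, so some ball carries mass above `3 / 4`. That radius serves every
finite-dimensional marginal in the sup norm, so the Fernique bound is uniform in `n` and passes to
`N` by monotone convergence. -/
lemma IsCenteredGaussianWithCov.integrable_supOn_abs [IsProbabilityMeasure P]
    (hX : IsCenteredGaussianWithCov P C X) (hXc : HasContinuousPathsOn P T X) :
    Integrable (fun ω => supOn T fun t => |X t ω|) P := by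
  obtain ⟨I, hI⟩ := exists_isDenseExhaustion T
  set N : Ω → ℝ := fun ω => supOn T fun t => |X t ω| with hN
  have hNm : AEMeasurable N P :=
    aemeasurable_supOn (X := fun t ω => |X t ω|) (fun t => (hX.aemeasurable t).abs)
      (hXc.mono fun ω hω => hω.abs)
  have hN0 : ∀ ω, 0 ≤ N ω := fun ω => Real.iSup_nonneg fun t => abs_nonneg _
  obtain ⟨k, hk⟩ : ∃ k : ℕ, ENNReal.ofReal (3 / 4) < P {ω | N ω ≤ k} := by
    have hmono : Monotone fun k : ℕ => {ω | N ω ≤ k} := fun i j hij ω (hω : N ω ≤ i) =>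
      hω.trans (Nat.cast_le.2 hij)
    have ht := tendsto_measure_iUnion_atTop (μ := P) hmono
    have hU : ⋃ k : ℕ, {ω | N ω ≤ k} = Set.univ :=
      Set.eq_univ_of_forall fun ω => Set.mem_iUnion.2 (exists_nat_ge (N ω))
    rw [hU, measure_univ] at ht
    have h34 : ENNReal.ofReal (3 / 4) < 1 := by
      rw [← ENNReal.ofReal_one]
      exact (ENNReal.ofReal_lt_ofReal_iff (by norm_num)).2 (by norm_num)
    exact (ht.eventually_const_lt h34).exists
  -- The radius must be positive, and `k` may be `0`.
  have ha : (0 : ℝ) < k + 1 := by positivity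
  obtain ⟨M, hM, hbound⟩ := exists_lintegral_norm_le_of_measure_ball_ge ha
  have hZ : ∀ n, ∫⁻ ω, ENNReal.ofReal ((I n).sup' (hI.nonempty n) fun t => |X t ω|) ∂P ≤ M := by
    intro n
    -- The plain function type carries the sup norm, so `‖V ω‖` is the finite maximum of `|X t ω|`.
    let V : Ω → (I n → ℝ) := fun ω i => X i ω
    have hV : HasGaussianLaw V P := hX.gaussian.hasGaussianLaw (I n)
    have := hV.isGaussian_map
    have hcent : (P.map V)[id] = 0 := by
      rw [integral_map hV.aemeasurable (by fun_prop)]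
      ext i
      simp only [id_eq]
      rw [eval_integral fun i : I n => (hX.memLp_two i).integrable one_le_two]
      exact hX.centered i
    have hball : ENNReal.ofReal (3 / 4) ≤ (P.map V) {x | ‖x‖ ≤ k + 1} := by
      rw [Measure.map_apply_of_aemeasurable hV.aemeasurable
        (measurableSet_le measurable_norm measurable_const)]
      refine hk.le.trans (measure_mono_ae ?_)
      filter_upwards [hXc] with ω hω (hωN : N ω ≤ k)
      change ‖V ω‖ ≤ k + 1
      refine (pi_norm_le_iff_of_nonneg ha.le).2 fun i => ?_
      have : |X i ω| ≤ N ω := le_supOn (x := fun t => |X t ω|) hω.abs (hI.subset n i.2)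
      rw [Real.norm_eq_abs]
      linarith
    refine le_trans ?_ (hbound _ (P.map V) hcent hball)
    rw [lintegral_map' (by fun_prop) hV.aemeasurable]
    refine lintegral_mono fun ω => ENNReal.ofReal_le_ofReal ?_
    exact Finset.sup'_le _ _ fun t ht => norm_le_pi_norm (V ω) ⟨t, ht⟩
  have hlim := lintegral_tendsto_of_tendsto_of_monotone (μ := P)
    (f := fun n ω => ENNReal.ofReal ((I n).sup' (hI.nonempty n) fun t => |X t ω|))
    (F := fun ω => ENNReal.ofReal (N ω))
    (fun n => (aemeasurable_finset_sup' (hI.nonempty n) fun t =>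
      (hX.aemeasurable t).abs).ennreal_ofReal)
    (.of_forall fun ω a b hab => ENNReal.ofReal_le_ofReal (hI.monotone_sup' _ hab))
    (hXc.mono fun ω hω => (ENNReal.continuous_ofReal.tendsto _).comp (hI.tendsto_sup' hω.abs))
  refine (lintegral_ofReal_ne_top_iff_integrable hNm.aestronglyMeasurable (.of_forall hN0)).1 ?_
  exact ((le_of_tendsto' hlim hZ).trans_lt hM).ne

lemma HasContinuousPathsOn.add_const (hXc : HasContinuousPathsOn P T X) {m : ℝ≥0 → ℝ}
    (hm : ContinuousOn m (Set.Icc 0 T)) : HasContinuousPathsOn P T fun t ω => X t ω + m t :=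
  hXc.mono fun _ hω => hω.add hm

lemma IsCenteredGaussianWithCov.integrable_supOn_add [IsProbabilityMeasure P]
    (hX : IsCenteredGaussianWithCov P C X) (hXc : HasContinuousPathsOn P T X) {m : ℝ≥0 → ℝ}
    (hm : ContinuousOn m (Set.Icc 0 T)) :
    Integrable (fun ω => supOn T fun t => X t ω + m t) P := by
  refine ((hX.integrable_supOn_abs hXc).add (integrable_const (supOn T fun t => |m t|))).mono'
    (aemeasurable_supOn (fun t => (hX.aemeasurable t).add_const _)
      (hXc.add_const hm)).aestronglyMeasurable ?_
  filter_upwards [hXc] with ω hω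
  exact abs_supOn_add_le hω hm

lemma IsCenteredGaussianWithCov.tendsto_lintegral_sup' (hX : IsCenteredGaussianWithCov P C X)
    {I : ℕ → Finset ℝ≥0} (hI : IsDenseExhaustion T I) (hXc : HasContinuousPathsOn P T X)
    {m : ℝ≥0 → ℝ} (hm : ContinuousOn m (Set.Icc 0 T)) {g : ℝ → ℝ}
    (hmono : Monotone g) (hg : ConvexOn ℝ Set.univ g) :
    Tendsto (fun n => ∫⁻ ω, ENNReal.ofReal
        (g ((I n).sup' (hI.nonempty n) fun t => X t ω + m t)) ∂P) atTop
      (𝓝 (∫⁻ ω, ENNReal.ofReal (g (supOn T fun t => X t ω + m t)) ∂P)) := by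
  have hgc : Continuous g := continuousOn_univ.1 (hg.continuousOn isOpen_univ)
  refine lintegral_tendsto_of_tendsto_of_monotone (fun n => ?_) ?_ ?_
  · exact (hgc.measurable.comp_aemeasurable (aemeasurable_finset_sup' (hI.nonempty n) fun t =>
      (hX.aemeasurable t).add_const (m t))).ennreal_ofReal
  · exact .of_forall fun ω a b hab =>
      ENNReal.ofReal_le_ofReal (hmono (hI.monotone_sup' _ hab))
  · filter_upwards [hXc] with ω hω
    exact ((ENNReal.continuous_ofReal.comp hgc).tendsto _).comp (hI.tendsto_sup' (hω.add hm))

/-- Comparison of the suprema of two Gaussian processes: if the covariance of `X'` dominates that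
of `X` in the positive semidefinite order, the supremum of `X'` plus a drift is larger than that
of `X` plus the drift in the increasing convex order. -/
lemma IsCenteredGaussianWithCov.lintegral_supOn_le [IsProbabilityMeasure P]
    [IsProbabilityMeasure P'] (hX : IsCenteredGaussianWithCov P C X)
    (hX' : IsCenteredGaussianWithCov P' C' X')
    (hCC' : ∀ I : Finset ℝ≥0, (Matrix.of fun i j : I => C' i j - C i j).PosSemidef)
    (hXc : HasContinuousPathsOn P T X) (hXc' : HasContinuousPathsOn P' T X')
    {m : ℝ≥0 → ℝ} (hm : ContinuousOn m (Set.Icc 0 T)) {g : ℝ → ℝ}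
    (hmono : Monotone g) (hg : ConvexOn ℝ Set.univ g) (h0 : ∀ x, 0 ≤ g x) :
    ∫⁻ ω, ENNReal.ofReal (g (supOn T fun t => X t ω + m t)) ∂P ≤
      ∫⁻ ω, ENNReal.ofReal (g (supOn T fun t => X' t ω + m t)) ∂P' := by
  obtain ⟨I, hI⟩ := exists_isDenseExhaustion T
  exact le_of_tendsto_of_tendsto' (hX.tendsto_lintegral_sup' hI hXc hm hmono hg)
    (hX'.tendsto_lintegral_sup' hI hXc' hm hmono hg) fun n =>
      hX.lintegral_sup'_le hX' (hI.nonempty n) (hCC' (I n)) m hmono hg h0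

end Supremum
-- From nonnegative test functions to extended expectations
open Filter Topology

section IncreasingConvexOrder

lemma ofReal_max_zero (z : ℝ) : ENNReal.ofReal (max z 0) = ENNReal.ofReal z := by
  rcases le_total 0 z with h | h
  · rw [max_eq_left h]
  · rw [max_eq_right h, ENNReal.ofReal_zero, ENNReal.ofReal_of_nonpos h]

variable {Ω Ω' : Type*} [MeasurableSpace Ω] [MeasurableSpace Ω'] {P : Measure Ω} {P' : Measure Ω'}
  {S : Ω → ℝ} {S' : Ω' → ℝ} {g : ℝ → ℝ}

/-- A convex function has an affine minorant, so the negative part of `g (S ω)` is controlled by an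
integrable affine function of `S ω`. -/
lemma hasExtExp_of_convexOn [IsFiniteMeasure P] (hS : Integrable S P) (hm : Monotone g)
    (hg : ConvexOn ℝ Set.univ g) : HasExtExp P fun ω => g (S ω) := by
  refine ⟨hm.measurable.comp_aemeasurable hS.aemeasurable, ?_⟩
  obtain ⟨a, b, hab⟩ := hg.exists_affine_le_real isClosed_univ
    (hg.continuousOn isOpen_univ).lowerSemicontinuousOn
  have hint : Integrable (fun ω => -(a * S ω + b)) P :=
    ((hS.const_mul a).add (integrable_const b)).neg
  refine lt_of_le_of_lt (lintegral_mono fun ω => ENNReal.ofReal_le_ofReal ?_)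
    hint.lintegral_lt_top
  exact neg_le_neg (hab _ (Set.mem_univ _))

lemma HasExtExp.integrable_of_lintegral_ne_top {Z : Ω → ℝ} (hZ : HasExtExp P Z)
    (h : ∫⁻ ω, ENNReal.ofReal (Z ω) ∂P ≠ ∞) : Integrable Z P := by
  have h1 : Integrable (fun ω => max (Z ω) 0) P :=
    (lintegral_ofReal_ne_top_iff_integrable (f := fun ω => max (Z ω) 0)
      (hZ.1.max aemeasurable_const).aestronglyMeasurable
      (.of_forall fun ω => le_max_right _ _)).1 (by simpa only [ofReal_max_zero] using h)
  have h2 : Integrable (fun ω => max (-Z ω) 0) P :=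
    (lintegral_ofReal_ne_top_iff_integrable (f := fun ω => max (-Z ω) 0)
      (hZ.1.neg.max aemeasurable_const).aestronglyMeasurable
      (.of_forall fun ω => le_max_right _ _)).1 (by simpa only [ofReal_max_zero] using hZ.2.ne)
  refine (h1.sub h2).congr (.of_forall fun ω => ?_)
  exact max_zero_sub_eq_self (Z ω)

lemma extExp_eq_integral {Z : Ω → ℝ} (hZ : Integrable Z P) : extExp P Z = (∫ ω, Z ω ∂P : ℝ) := by
  rw [extExp, integral_eq_lintegral_pos_part_sub_lintegral_neg_part hZ, EReal.coe_sub,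
    EReal.coe_ennreal_toReal, EReal.coe_ennreal_toReal]
  · exact hZ.neg.lintegral_lt_top.ne
  · exact hZ.lintegral_lt_top.ne

lemma integral_max_neg_tendsto {Z : Ω → ℝ} (hZ : Integrable Z P) :
    Tendsto (fun n : ℕ => ∫ ω, max (Z ω) (-(n : ℝ)) ∂P) atTop (𝓝 (∫ ω, Z ω ∂P)) := by
  refine tendsto_integral_of_dominated_convergence (fun ω => |Z ω|)
    (fun n => (hZ.aemeasurable.max aemeasurable_const).aestronglyMeasurable) hZ.abs
    (fun n => .of_forall fun ω => ?_) (.of_forall fun ω => ?_)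
  · rw [Real.norm_eq_abs, abs_le]
    have hn : (0 : ℝ) ≤ n := n.cast_nonneg
    refine ⟨(neg_abs_le _).trans (le_max_left _ _), max_le (le_abs_self _) ?_⟩
    linarith [abs_nonneg (Z ω)]
  · refine tendsto_const_nhds.congr' ?_
    obtain ⟨k, hk⟩ := exists_nat_ge (-Z ω)
    filter_upwards [eventually_ge_atTop k] with n hn
    have : (k : ℝ) ≤ n := Nat.cast_le.2 hn
    exact (max_eq_left (by linarith)).symm

/-- If `S` is below `S'` for all nonnegative monotone convex test functions, then the integrals of
a monotone convex function bounded below are ordered. -/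
lemma integral_le_of_forall_lintegral_le [IsProbabilityMeasure P] [IsProbabilityMeasure P']
    (h : ∀ f : ℝ → ℝ, Monotone f → ConvexOn ℝ Set.univ f → (∀ x, 0 ≤ f x) →
      ∫⁻ ω, ENNReal.ofReal (f (S ω)) ∂P ≤ ∫⁻ ω, ENNReal.ofReal (f (S' ω)) ∂P')
    (hm : Monotone g) (hg : ConvexOn ℝ Set.univ g) {b : ℝ} (hb : ∀ x, b ≤ g x)
    (hi : Integrable (fun ω => g (S ω)) P) (hi' : Integrable (fun ω => g (S' ω)) P') :
    ∫ ω, g (S ω) ∂P ≤ ∫ ω, g (S' ω) ∂P' := by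
  -- Subtracting the lower bound makes the test function nonnegative; on probability spaces the
  -- shift contributes equally to both sides.
  have h1 := h (fun x => g x + -b) (fun x y hxy => add_le_add_left (hm hxy) _)
    (hg.add_const _) fun x => by linarith [hb x]
  have hib : Integrable (fun ω => g (S ω) + -b) P := hi.add (integrable_const _)
  have hib' : Integrable (fun ω => g (S' ω) + -b) P' := hi'.add (integrable_const _)
  rw [← ofReal_integral_eq_lintegral_ofReal hib
      (.of_forall fun ω => by simpa using hb _),
    ← ofReal_integral_eq_lintegral_ofReal hib'
      (.of_forall fun ω => by simpa using hb _),
    ENNReal.ofReal_le_ofReal_iff (integral_nonneg fun ω => by simpa using hb _),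
    integral_add hi (integrable_const _), integral_add hi' (integrable_const _)] at h1
  simpa using h1

/-- If the right-hand side is finite, comparing positive parts makes both variables integrable. The
truncations `max g (-n)` are bounded below, hence comparable, and dominated convergence removes the
truncation. -/
lemma extExp_le_of_forall_lintegral_le [IsProbabilityMeasure P] [IsProbabilityMeasure P']
    (hS : Integrable S P) (hS' : Integrable S' P')
    (h : ∀ f : ℝ → ℝ, Monotone f → ConvexOn ℝ Set.univ f → (∀ x, 0 ≤ f x) →
      ∫⁻ ω, ENNReal.ofReal (f (S ω)) ∂P ≤ ∫⁻ ω, ENNReal.ofReal (f (S' ω)) ∂P')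
    (hm : Monotone g) (hg : ConvexOn ℝ Set.univ g) :
    extExp P (fun ω => g (S ω)) ≤ extExp P' fun ω => g (S' ω) := by
  have hZ := hasExtExp_of_convexOn hS hm hg
  have hZ' := hasExtExp_of_convexOn hS' hm hg
  by_cases htop : ∫⁻ ω, ENNReal.ofReal (g (S' ω)) ∂P' = ∞
  · have : extExp P' (fun ω => g (S' ω)) = ⊤ := by
      rw [extExp, htop, EReal.coe_ennreal_top]
      exact EReal.top_sub (by simpa using hZ'.2.ne)
    rw [this]
    exact le_top
  have hpos := h (fun x => max (g x) 0) (hm.max monotone_const)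
    (hg.sup (convexOn_const 0 convex_univ)) fun x => le_max_right _ _
  simp only [ofReal_max_zero] at hpos
  have hi' := hZ'.integrable_of_lintegral_ne_top htop
  have hi := hZ.integrable_of_lintegral_ne_top (ne_top_of_le_ne_top htop hpos)
  rw [extExp_eq_integral hi, extExp_eq_integral hi', EReal.coe_le_coe_iff]
  refine le_of_tendsto_of_tendsto' (integral_max_neg_tendsto hi) (integral_max_neg_tendsto hi')
    fun n => ?_
  exact integral_le_of_forall_lintegral_le (g := fun x => max (g x) (-(n : ℝ))) h
    (hm.max monotone_const) (hg.sup (convexOn_const _ convex_univ)) (fun x => le_max_right _ _)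
    (hi.sup (integrable_const _)) (hi'.sup (integrable_const _))

/-- Layer-cake formula for the positive part of `S - t`, followed by the translation `u ↦ u + t`. -/
lemma lintegral_Ioi_measure_lt_eq [IsFiniteMeasure P] (hS : Integrable S P) (t : ℝ) :
    ∫⁻ u in Set.Ioi t, P {ω | u < S ω} = ENNReal.ofReal (∫ ω, max (S ω - t) 0 ∂P) := by
  have hi : Integrable (fun ω => max (S ω - t) 0) P :=
    (hS.sub (integrable_const t)).sup (integrable_const (0 : ℝ))
  rw [ofReal_integral_eq_lintegral_ofReal hi (.of_forall fun ω => le_max_right _ _),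
    lintegral_eq_lintegral_meas_lt P (f := fun ω => max (S ω - t) 0)
      (.of_forall fun ω => le_max_right _ _) hi.aemeasurable]
  have hmp := (measurePreserving_add_right (volume : Measure ℝ) t)
  have hme := (MeasurableEquiv.addRight t).measurableEmbedding
  have h := hmp.setLIntegral_comp_preimage_emb hme (fun u => P {ω | u < S ω}) (Set.Ioi t)
  rw [← h]
  have hpre : (fun x => x + t) ⁻¹' Set.Ioi t = Set.Ioi 0 := by ext x; simp
  rw [hpre]
  refine setLIntegral_congr_fun measurableSet_Ioi fun u (hu : 0 < u) => ?_
  congr 1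
  ext ω
  simp [lt_sub_iff_add_lt, hu.le.not_gt]

end IncreasingConvexOrder

/-! ### The comparison for bifractional Brownian motion -/

theorem theorem2p11
    {Ω Ω' : Type*} [MeasurableSpace Ω] [MeasurableSpace Ω']
    (P : Measure Ω) [IsProbabilityMeasure P] (P' : Measure Ω') [IsProbabilityMeasure P']
    (H K : ℝ) (hH0 : 0 < H) (hH1 : H < 1) (hK0 : 0 < K) (hK1 : K ≤ 1) (T : ℝ≥0)
    (W : ℝ≥0 → Ω → ℝ) (hW : IsBifBM P H K W) (hWc : HasContinuousPathsOn P T W)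
    (B : ℝ≥0 → Ω' → ℝ) (hB : IsFBM P' (H * K) B) (hBc : HasContinuousPathsOn P' T B)
    (Y : ℝ≥0 → Ω' → ℝ) (hY : ∀ t ω, Y t ω = (2 : ℝ) ^ ((1 - K) / 2) * B t ω) :
    (∀ m : ℝ≥0 → ℝ, ContinuousOn m (Set.Icc 0 T) →
      (∀ c : ℝ,
        Integrable (fun ω => supOn T (fun t => max (W t ω + m t) c)) P ∧
        Integrable (fun ω => supOn T (fun t => max (Y t ω + m t) c)) P' ∧
        ∫ ω, supOn T (fun t => max (W t ω + m t) c) ∂P ≤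
          ∫ ω, supOn T (fun t => max (Y t ω + m t) c) ∂P') ∧
      (∀ g : ℝ → ℝ, Monotone g → ConvexOn ℝ Set.univ g →
        HasExtExp P (fun ω => g (supOn T (fun t => W t ω + m t))) ∧
        HasExtExp P' (fun ω => g (supOn T (fun t => Y t ω + m t))) ∧
        extExp P (fun ω => g (supOn T (fun t => W t ω + m t))) ≤
          extExp P' (fun ω => g (supOn T (fun t => Y t ω + m t))))) ∧
    (∀ t : ℝ,
      -- the integrated tails
      ∫⁻ u in Set.Ioi t, P {ω | u < supOn T (fun s => W s ω)} ≤
        ∫⁻ u in Set.Ioi t, P' {ω | u < supOn T (fun s => Y s ω)} ∧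
      -- the equivalent form through positive parts
      Integrable (fun ω => max (supOn T (fun s => W s ω) - t) 0) P ∧
      Integrable (fun ω => max (supOn T (fun s => Y s ω) - t) 0) P' ∧
      ∫ ω, max (supOn T (fun s => W s ω) - t) 0 ∂P ≤
        ∫ ω, max (supOn T (fun s => Y s ω) - t) 0 ∂P' ∧
      -- the two forms agree, for each of the processes
      ∫⁻ u in Set.Ioi t, P {ω | u < supOn T (fun s => W s ω)} =
        ENNReal.ofReal (∫ ω, max (supOn T (fun s => W s ω) - t) 0 ∂P) ∧
      ∫⁻ u in Set.Ioi t, P' {ω | u < supOn T (fun s => Y s ω)} =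
        ENNReal.ofReal (∫ ω, max (supOn T (fun s => Y s ω) - t) 0 ∂P')) := by 
  have hWg : IsCenteredGaussianWithCov P (bifbmCov H K) W := hW
  have hYg : IsCenteredGaussianWithCov P' (fun s t => (2 : ℝ) ^ ((1 - K) / 2) *
      (2 : ℝ) ^ ((1 - K) / 2) * fbmCov (H * K) s t) Y := by
    have hYeq : Y = fun t ω => (2 : ℝ) ^ ((1 - K) / 2) * B t ω :=
      funext fun t => funext fun ω => hY t ω
    rw [hYeq]
    exact IsCenteredGaussianWithCov.const_mul hB _
  have hYc : HasContinuousPathsOn P' T Y := by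
    filter_upwards [hBc] with ω hω
    simp_rw [hY]
    exact continuousOn_const.mul hω
  have hcmp : ∀ m : ℝ≥0 → ℝ, ContinuousOn m (Set.Icc 0 T) → ∀ f : ℝ → ℝ, Monotone f →
      ConvexOn ℝ Set.univ f → (∀ x, 0 ≤ f x) →
      ∫⁻ ω, ENNReal.ofReal (f (supOn T fun t => W t ω + m t)) ∂P ≤
        ∫⁻ ω, ENNReal.ofReal (f (supOn T fun t => Y t ω + m t)) ∂P' :=
    fun m hm f hf1 hf2 hf3 => hWg.lintegral_supOn_le hYg
      (posSemidef_fbmCov_sub_bifbmCov hK0 hK1) hWc hYc hm hf1 hf2 hf3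
  have hiW := fun m hm => hWg.integrable_supOn_add (m := m) hWc hm
  have hiY := fun m hm => hYg.integrable_supOn_add (m := m) hYc hm
  refine ⟨fun m hm => ⟨fun c => ?_, fun g hg1 hg2 => ?_⟩, fun t => ?_⟩
  -- Exchanging the maximum with `c` and the supremum needs a path bounded above, so it is claimed
  -- only almost surely.
  · have hW' : (fun ω => max (supOn T fun t => W t ω + m t) c) =ᵐ[P]
        fun ω => supOn T fun t => max (W t ω + m t) c := by
      filter_upwards [hWc.add_const hm] with ω hω
      exact (supOn_max_const hω c).symm
    have hY' : (fun ω => max (supOn T fun t => Y t ω + m t) c) =ᵐ[P']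
        fun ω => supOn T fun t => max (Y t ω + m t) c := by
      filter_upwards [hYc.add_const hm] with ω hω
      exact (supOn_max_const hω c).symm
    have h1 := (hiW m hm).sup (integrable_const c)
    have h2 := (hiY m hm).sup (integrable_const c)
    refine ⟨h1.congr hW', h2.congr hY', ?_⟩
    rw [← integral_congr_ae hW', ← integral_congr_ae hY']
    exact integral_le_of_forall_lintegral_le (g := fun x => max x c) (hcmp m hm)
      (monotone_id.max monotone_const) ((convexOn_id convex_univ).sup
        (convexOn_const c convex_univ)) (fun x => le_max_right _ _) h1 h2
  · exact ⟨hasExtExp_of_convexOn (hiW m hm) hg1 hg2, hasExtExp_of_convexOn (hiY m hm) hg1 hg2,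
      extExp_le_of_forall_lintegral_le (hiW m hm) (hiY m hm) (hcmp m hm) hg1 hg2⟩
  · have hSW : Integrable (fun ω => supOn T fun s => W s ω) P := by
      simpa using hiW (fun _ => 0) continuousOn_const
    have hSY : Integrable (fun ω => supOn T fun s => Y s ω) P' := by
      simpa using hiY (fun _ => 0) continuousOn_const
    have h1 : Integrable (fun ω => max (supOn T (fun s => W s ω) - t) 0) P :=
      (hSW.sub (integrable_const t)).sup (integrable_const (0 : ℝ))
    have h2 : Integrable (fun ω => max (supOn T (fun s => Y s ω) - t) 0) P' :=
      (hSY.sub (integrable_const t)).sup (integrable_const (0 : ℝ))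
    have hle : ∫ ω, max (supOn T (fun s => W s ω) - t) 0 ∂P ≤
        ∫ ω, max (supOn T (fun s => Y s ω) - t) 0 ∂P' := by
      -- The tail comparison is the case of zero drift with the test function `max (x - t) 0`.
      have h0 := hcmp (fun _ => 0) continuousOn_const
      simp only [add_zero] at h0
      refine integral_le_of_forall_lintegral_le (g := fun x => max (x - t) 0) h0
        (fun x y hxy => max_le_max_right _ (sub_le_sub_right hxy t)) ?_
        (fun x => le_max_right _ _) h1 h2
      simp_rw [sub_eq_add_neg]
      exact ((convexOn_id convex_univ).add_const (-t)).sup (convexOn_const 0 convex_univ)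
    have htW := lintegral_Ioi_measure_lt_eq hSW t
    have htY := lintegral_Ioi_measure_lt_eq hSY t
    refine ⟨?_, h1, h2, hle, htW, htY⟩
    rw [htW, htY]
    exact ENNReal.ofReal_le_ofReal hle
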